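/- For each $n\ge 1$ let $m_n$ be a positive integer, let $X_n$ be a random variable with values in $\{1,\dots,m_n\}$ and $p_n(i):=\mathbb P(X_n=i)>0$ for $i=1,\dots,m_n$, and let $X_{n,1},\dots,X_{n,n}$ be independent random variables, each with the same distribution as $X_n$. (No relation between the rows for different $n$ is assumed.) Let $$\hat p_n(i)=\frac1n\sum_{k=1}^n I(X_{n,k}=i),\qquad \chi_n^2=n\sum_{i=1}^{m_n}\frac{(\hat p_n(i)-p_n(i))^2}{p_n(i)}$$ be the empirical frequencies and the Pearson chi-square statistic. Assume that, as $n\to\infty$, $$\text{(C)}\quad \frac{1}{m_n n}\,\mathrm{Var}\!\left(\frac1{p_n(X_n)}\right)\to 0\qquad\text{and}\qquad \frac{n}{\sqrt{m_n}}\to\lambda\in(0,\infty).$$ Then $$\frac{\chi_n^2-m_n}{\sqrt{2m_n}}\ \xrightarrow{d}\ \frac{\sqrt2}{\lambda}\,Z-\frac{\lambda}{\sqrt2},\qquad Z\sim\mathrm{Poisson}\!\left(\frac{\lambda^2}{2}\right).$$ -/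

import Mathlib

open MeasureTheory ProbabilityTheory Filter Topology

noncomputable section

/-- The empirical frequency of class `i` in the sample `x 0, …, x (n-1)`. -/
def empiricalFreq {n m : ℕ} (x : Fin n → Fin m) (i : Fin m) : ℝ :=
  (n : ℝ)⁻¹ * ∑ k : Fin n, if x k = i then (1 : ℝ) else 0

/-- The Pearson chi-square statistic of the sample `x` of size `n` for the class
probabilities `p` on `m` classes. -/
def pearsonChiSq {n m : ℕ} (p : Fin m → ℝ) (x : Fin n → Fin m) : ℝ :=
  (n : ℝ) * ∑ i : Fin m, (empiricalFreq x i - p i) ^ 2 / p i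

end

/-!
Write `m` for the number of classes, `p` for the class probabilities and `w i = 1 / (m p i)`. Up to
an affine map, Pearson's statistic is `S + R / 2`, where `S = ∑ i, w i * (count i).choose 2` counts
the colliding pairs of observations with weights, and `R` is a centred sum of `n` independent terms
of variance `V = Var (w X)`. Condition (C) says `n V → 0`, so `R` vanishes and, `w` being close to
`1`, `S` behaves like an integer-valued collision count.

A new observation raises `S` by `w j * count j` when it falls in class `j`, which happens with
probability `p j = 1 / (m w j)`. Hence, to first order, the `(l + 1)`-st observation multiplies the
characteristic function of `S` by `1 + (l / m) (exp (i θ) - 1)`, whatever the sample so far: the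
weights cancel the fluctuation of the class probabilities, and no concentration estimate is needed.
Multiplying over `l < n` gives `exp ((n.choose 2 / m) (exp (i θ) - 1))`, the characteristic
function of a Poisson law with parameter `n.choose 2 / m → λ² / 2`.
-/

section ExpBounds

open Complex (exp I)

lemma norm_exp_ofReal_mul_I_sub_le (u v : ℝ) : ‖exp (u * I) - exp (v * I)‖ ≤ |u - v| := by
  have hfactor : exp (u * I) - exp (v * I) = exp (v * I) * (exp (I * (u - v : ℝ)) - 1) := by
    rw [mul_sub, ← Complex.exp_add, mul_one]
    congr 2
    push_cast
    ring
  rw [hfactor, norm_mul, Complex.norm_exp_ofReal_mul_I, one_mul]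
  exact Real.norm_exp_I_mul_ofReal_sub_one_le

lemma norm_exp_ofReal_mul_I_sub_one_le (u : ℝ) : ‖exp (u * I) - 1‖ ≤ |u| := by
  simpa using norm_exp_ofReal_mul_I_sub_le u 0

lemma norm_exp_natCast_mul_I_sub_one_sub_le (θ : ℝ) (k : ℕ) :
    ‖exp ((θ * k : ℝ) * I) - 1 - k * (exp (θ * I) - 1)‖ ≤ θ ^ 2 * k.choose 2 := by
  induction k with
  | zero => simp
  | succ k ih =>
    have hstep : exp ((θ * (k + 1 : ℕ) : ℝ) * I) - 1 - (k + 1 : ℕ) * (exp (θ * I) - 1)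
        = (exp ((θ * k : ℝ) * I) - 1 - k * (exp (θ * I) - 1))
          + (exp ((θ * k : ℝ) * I) - 1) * (exp (θ * I) - 1) := by
      have hexp : exp ((θ * (k + 1 : ℕ) : ℝ) * I) = exp ((θ * k : ℝ) * I) * exp (θ * I) := by
        rw [← Complex.exp_add]
        congr 1
        push_cast
        ring
      rw [hexp]
      push_cast
      ring
    have hprod : ‖(exp ((θ * k : ℝ) * I) - 1) * (exp (θ * I) - 1)‖ ≤ θ ^ 2 * k := by
      calc _ ≤ |θ * k| * |θ| := by
            rw [norm_mul]
            gcongr <;> exact norm_exp_ofReal_mul_I_sub_one_le _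
        _ = θ ^ 2 * k := by rw [abs_mul, Nat.abs_cast, ← sq_abs]; ring
    rw [hstep, Nat.choose_succ_succ' k 1, Nat.choose_one_right, Nat.cast_add, mul_add]
    linarith [norm_add_le (exp ((θ * k : ℝ) * I) - 1 - k * (exp (θ * I) - 1))
      ((exp ((θ * k : ℝ) * I) - 1) * (exp (θ * I) - 1))]

lemma norm_exp_mul_I_sub_one_sub_le (θ w : ℝ) (k : ℕ) :
    ‖exp ((θ * (w * k) : ℝ) * I) - 1 - w * k * (exp (θ * I) - 1)‖
      ≤ 2 * |θ| * (|w - 1| * k) + θ ^ 2 * k.choose 2 := by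
  have hsplit : exp ((θ * (w * k) : ℝ) * I) - 1 - w * k * (exp (θ * I) - 1)
      = (exp ((θ * (w * k) : ℝ) * I) - exp ((θ * k : ℝ) * I))
        + (exp ((θ * k : ℝ) * I) - 1 - k * (exp (θ * I) - 1))
        - ((w - 1) * k : ℝ) * (exp (θ * I) - 1) := by
    push_cast
    ring
  have hphase : ‖exp ((θ * (w * k) : ℝ) * I) - exp ((θ * k : ℝ) * I)‖ ≤ |θ| * (|w - 1| * k) := by
    refine (norm_exp_ofReal_mul_I_sub_le _ _).trans_eq ?_
    rw [← Nat.abs_cast k, ← abs_mul, ← abs_mul, Nat.abs_cast]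
    congr 1
    ring
  have hlinear : ‖((w - 1) * k : ℝ) * (exp (θ * I) - 1)‖ ≤ |θ| * (|w - 1| * k) := by
    rw [norm_mul, Complex.norm_real, Real.norm_eq_abs, abs_mul, Nat.abs_cast, mul_comm |θ|]
    gcongr
    exact norm_exp_ofReal_mul_I_sub_one_le θ
  rw [hsplit]
  linarith [norm_sub_le
      ((exp ((θ * (w * k) : ℝ) * I) - exp ((θ * k : ℝ) * I))
        + (exp ((θ * k : ℝ) * I) - 1 - k * (exp (θ * I) - 1)))
      (((w - 1) * k : ℝ) * (exp (θ * I) - 1)),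
    norm_add_le (exp ((θ * (w * k) : ℝ) * I) - exp ((θ * k : ℝ) * I))
      (exp ((θ * k : ℝ) * I) - 1 - k * (exp (θ * I) - 1)),
    norm_exp_natCast_mul_I_sub_one_sub_le θ k]

lemma norm_exp_le_one_of_re_nonpos {u : ℂ} (hu : u.re ≤ 0) : ‖exp u‖ ≤ 1 := by
  rwa [Complex.norm_exp, Real.exp_le_one_iff]

lemma norm_exp_sub_one_sub_id_le_of_re_nonpos {u : ℂ} (hu : u.re ≤ 0) :
    ‖exp u - 1 - u‖ ≤ 3 * ‖u‖ ^ 2 := by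
  rcases le_total ‖u‖ 1 with h | h
  · linarith [Complex.norm_exp_sub_one_sub_id_le h, sq_nonneg ‖u‖]
  · calc ‖exp u - 1 - u‖ ≤ ‖exp u‖ + ‖(1 : ℂ)‖ + ‖u‖ :=
          (norm_sub_le _ _).trans (add_le_add_left (norm_sub_le _ _) _)
      _ ≤ 1 + 1 + ‖u‖ := by
          rw [norm_one]
          gcongr
          exact norm_exp_le_one_of_re_nonpos hu
      _ ≤ 3 * ‖u‖ ^ 2 := by nlinarith

lemma re_natCast_div_mul_exp_sub_one_nonpos (k l : ℕ) (θ : ℝ) :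
    (k / l * (exp (θ * I) - 1) : ℂ).re ≤ 0 := by
  have hcast : (k / l : ℂ) = ((k / l : ℝ) : ℂ) := by push_cast; rfl
  rw [hcast, Complex.re_ofReal_mul, Complex.sub_re, Complex.exp_ofReal_mul_I_re, Complex.one_re]
  exact mul_nonpos_of_nonneg_of_nonpos (by positivity) (by linarith [Real.cos_le_one θ])

end ExpBounds

lemma norm_sub_prod_range_le {R : Type*} [SeminormedCommRing R] {G e : ℕ → R} {B : ℝ} {n : ℕ}
    (hG : G 0 = 1) (he : ∀ l < n, ‖e l‖ ≤ 1) (hstep : ∀ l < n, ‖G (l + 1) - G l * e l‖ ≤ B) :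
    ‖G n - ∏ l ∈ Finset.range n, e l‖ ≤ n * B := by
  induction n with
  | zero => simp [hG]
  | succ n ih =>
    have hprev := ih (fun l hl => he l (by lia)) (fun l hl => hstep l (by lia))
    have hsplit : G (n + 1) - ∏ l ∈ Finset.range (n + 1), e l
        = (G (n + 1) - G n * e n) + (G n - ∏ l ∈ Finset.range n, e l) * e n := by
      rw [Finset.prod_range_succ]
      ring
    calc _ ≤ B + n * B * 1 := by
          rw [hsplit]
          refine (norm_add_le _ _).trans (add_le_add (hstep n n.lt_succ_self) ?_)
          refine (norm_mul_le _ _).trans ?_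
          gcongr
          · exact (norm_nonneg _).trans hprev
          · exact he n n.lt_succ_self
      _ = (n + 1 : ℕ) * B := by push_cast; ring

section CharFun

variable {Ω : Type*} [MeasurableSpace Ω] {P : Measure Ω}

open Complex (exp I)

lemma charFun_map_eq_integral {f : Ω → ℝ} (hf : AEMeasurable f P) (t : ℝ) :
    charFun (P.map f) t = ∫ ω, exp ((t * f ω : ℝ) * I) ∂P := by
  rw [charFun_apply_real, integral_map hf (by fun_prop)]
  simp only [Complex.ofReal_mul]

lemma norm_charFun_map_sub_le [IsFiniteMeasure P] {f g : Ω → ℝ} (hf : AEMeasurable f P)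
    (hg : AEMeasurable g P) (hfg : Integrable (fun ω => f ω - g ω) P) (t : ℝ) :
    ‖charFun (P.map f) t - charFun (P.map g) t‖ ≤ |t| * ∫ ω, |f ω - g ω| ∂P := by
  have hint {h : Ω → ℝ} (hh : AEMeasurable h P) :
      Integrable (fun ω => exp ((t * h ω : ℝ) * I)) P :=
    .of_bound (by fun_prop) 1 (ae_of_all _ fun ω => (Complex.norm_exp_ofReal_mul_I _).le)
  rw [charFun_map_eq_integral hf, charFun_map_eq_integral hg, ← integral_sub (hint hf) (hint hg),
    ← integral_const_mul]
  refine norm_integral_le_of_norm_le (hfg.abs.const_mul _) (ae_of_all _ fun ω => ?_)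
  rw [← abs_mul, mul_sub]
  exact norm_exp_ofReal_mul_I_sub_le _ _

lemma charFun_map_mul_sub {f : Ω → ℝ} (hf : AEMeasurable f P) (a b t : ℝ) :
    charFun (P.map fun ω => a * f ω - b) t
      = exp ((-(t * b) : ℝ) * I) * charFun (P.map f) (t * a) := by
  rw [charFun_map_eq_integral (by fun_prop), charFun_map_eq_integral hf, ← integral_const_mul]
  congr with ω
  rw [← Complex.exp_add]
  congr 1
  push_cast
  ring

lemma charFun_map_mul_natCast_sub {Z : Ω → ℕ} {r : NNReal} (hZ : HasLaw Z (poissonMeasure r) P)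
    (a b t : ℝ) :
    charFun (P.map fun ω => a * (Z ω : ℝ) - b) t
      = exp ((-(t * b) : ℝ) * I)
        * exp (r * (exp ((t * a : ℝ) * I) - 1)) := by
  have hlaw : P.map (fun ω => (Z ω : ℝ)) = (poissonMeasure r).map (Nat.cast : ℕ → ℝ) := by
    rw [← hZ.map_eq, AEMeasurable.map_map_of_aemeasurable .of_discrete hZ.aemeasurable]
    rfl
  have := hZ.aemeasurable
  rw [charFun_map_mul_sub (by fun_prop), hlaw, charFun_map_cast_poissonMeasure]

lemma integral_abs_sub_integral_le_sqrt_variance [IsProbabilityMeasure P] {f : Ω → ℝ}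
    (hf : MemLp f 2 P) : ∫ ω, |f ω - ∫ ω', f ω' ∂P| ∂P ≤ √Var[f; P] := by
  apply Real.le_sqrt_of_sq_le
  have hdev : MemLp (fun ω => |f ω - ∫ ω', f ω' ∂P|) 2 P := (hf.sub (memLp_const _)).abs
  have hvar := variance_nonneg (fun ω => |f ω - ∫ ω', f ω' ∂P|) P
  rw [variance_eq_sub hdev] at hvar
  simp only [Pi.pow_apply, sq_abs] at hvar
  rw [variance_eq_integral hf.aemeasurable]
  linarith

end CharFun

section Counts

variable {ι : Type*} [DecidableEq ι] {n : ℕ}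

/-- The number of observations of the sample `x` that fall in class `i`. -/
def sampleCount (x : Fin n → ι) (i : ι) : ℕ := Finset.card {k | x k = i}

lemma sampleCount_cons (j : ι) (x : Fin n → ι) (i : ι) :
    sampleCount (Fin.cons j x : Fin (n + 1) → ι) i
      = sampleCount x i + if j = i then 1 else 0 := by
  simp only [sampleCount, Fin.card_filter_univ_succ', Fin.cons_zero, Fin.cons_succ, add_comm]

lemma choose_sampleCount_cons (j : ι) (x : Fin n → ι) (i : ι) (k : ℕ) :
    (sampleCount (Fin.cons j x : Fin (n + 1) → ι) i).choose (k + 1)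
      = (sampleCount x i).choose (k + 1) + if j = i then (sampleCount x i).choose k else 0 := by
  rw [sampleCount_cons]
  split_ifs
  · rw [Nat.choose_succ_succ', add_comm]
  · rfl

lemma sum_mul_sampleCount {R : Type*} [CommSemiring R] [Fintype ι] (g : ι → R) (x : Fin n → ι) :
    ∑ i, g i * sampleCount x i = ∑ k, g (x k) := by
  simp only [sampleCount, Finset.card_filter, Nat.cast_sum, Nat.cast_ite, Nat.cast_one,
    Nat.cast_zero, Finset.mul_sum]
  rw [Finset.sum_comm]
  simp

lemma sum_sampleCount [Fintype ι] (x : Fin n → ι) : ∑ i, sampleCount x i = n := by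
  simpa using sum_mul_sampleCount (R := ℕ) (fun _ => 1) x

end Counts

section SampleLaw

variable {ι : Type*} [MeasurableSpace ι]

/-- The law of a sample of `n` independent observations with law `μ`. -/
noncomputable abbrev sampleLaw (μ : Measure ι) (n : ℕ) : Measure (Fin n → ι) :=
  Measure.pi fun _ => μ

lemma hasLaw_sampleLaw {Ω : Type*} [MeasurableSpace Ω] {P : Measure Ω} {n : ℕ} {X₀ : Ω → ι}
    {X : Fin n → Ω → ι} (hindep : iIndepFun X P) (hident : ∀ k, IdentDistrib (X k) X₀ P P) :
    HasLaw (fun ω k => X k ω) (sampleLaw (P.map X₀) n) P :=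
  hindep.hasLaw_pi fun k => ⟨(hident k).aemeasurable_fst, (hident k).map_eq⟩

lemma integral_abs_sum_sub_integral_le {μ : Measure ι} [IsProbabilityMeasure μ] {g : ι → ℝ}
    (hg : MemLp g 2 μ) (n : ℕ) :
    ∫ x, |∑ k, (g (x k) - ∫ i, g i ∂μ)| ∂sampleLaw μ n ≤ √(n * Var[g; μ]) := by
  have hg_eval (k : Fin n) : MemLp (fun x : Fin n → ι => g (x k)) 2 (sampleLaw μ n) :=
    hg.comp_measurePreserving (measurePreserving_eval _ k)
  have hmean : ∫ x, ∑ k, g (x k) ∂sampleLaw μ n = ∑ _k : Fin n, ∫ i, g i ∂μ := by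
    rw [integral_finsetSum _ fun k _ => (hg_eval k).integrable one_le_two]
    exact Finset.sum_congr rfl fun k _ =>
      integral_comp_eval (μ := fun _ : Fin n => μ) (i := k) hg.aestronglyMeasurable
  have hvar : Var[fun x => ∑ k, g (x k); sampleLaw μ n] = n * Var[g; μ] := by
    have := variance_sum_pi (ι := Fin n) (μ := fun _ => μ) (X := fun _ => g) fun _ => hg
    simpa [Finset.sum_fn] using this
  simp only [Finset.sum_sub_distrib]
  rw [← hvar, ← hmean]
  exact integral_abs_sub_integral_le_sqrt_variance (memLp_finsetSum _ fun k _ => hg_eval k)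

variable (μ : Measure ι) [MeasurableSingletonClass ι]

lemma integral_sampleLaw_succ [Fintype ι] [IsFiniteMeasure μ] {n : ℕ} {E : Type*}
    [NormedAddCommGroup E] [NormedSpace ℝ E] [CompleteSpace E] (f : (Fin (n + 1) → ι) → E) :
    ∫ x, f x ∂sampleLaw μ (n + 1)
      = ∫ x, ∑ j, μ.real {j} • f (Fin.cons j x) ∂sampleLaw μ n := by
  rw [← (measurePreserving_piFinSuccAbove (fun _ => μ) 0).symm.integral_comp',
    integral_prod_symm _ .of_finite]
  congr with x
  rw [integral_fintype .of_finite]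
  simp [MeasurableEquiv.piFinSuccAbove_symm_apply, Fin.insertNthEquiv, Fin.insertNth_zero']

variable [IsProbabilityMeasure μ]

lemma integral_choose_sampleCount [Finite ι] [DecidableEq ι] (n k : ℕ) (i : ι) :
    ∫ x, ((sampleCount x i).choose k : ℝ) ∂sampleLaw μ n = n.choose k * μ.real {i} ^ k := by
  have := Fintype.ofFinite ι
  induction n generalizing k with
  | zero => cases k <;> simp [sampleCount]
  | succ n ih =>
    cases k with
    | zero => simp
    | succ k =>
      have hcons (x : Fin n → ι) :
          ∑ j, μ.real {j} • ((sampleCount (Fin.cons j x : Fin (n + 1) → ι) i).choose (k + 1) : ℝ)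
            = (sampleCount x i).choose (k + 1) + μ.real {i} * (sampleCount x i).choose k := by
        simp [choose_sampleCount_cons, mul_add, Finset.sum_add_distrib, ← Finset.sum_mul]
      rw [integral_sampleLaw_succ]
      simp only [hcons]
      rw [integral_add .of_finite .of_finite, integral_const_mul, ih, ih, Nat.choose_succ_succ']
      push_cast
      ring

lemma integral_sampleCount [Finite ι] [DecidableEq ι] (n : ℕ) (i : ι) :
    ∫ x, (sampleCount x i : ℝ) ∂sampleLaw μ n = n * μ.real {i} := by
  simpa using integral_choose_sampleCount μ n 1 i

end SampleLaw

section UniformRatio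

variable {ι : Type*} [Fintype ι] [MeasurableSpace ι] (μ : Measure ι)

/-- The likelihood ratio `i ↦ 1 / (m p(i))` of the uniform law on the `m` classes with respect to
`μ`. Its variance under `μ` is the chi-square divergence that condition (C) controls. -/
noncomputable def uniformRatio (i : ι) : ℝ := (Fintype.card ι * μ.real {i})⁻¹

variable {μ}

lemma measureReal_mul_uniformRatio {i : ι} (hi : μ.real {i} ≠ 0) :
    μ.real {i} * uniformRatio μ i = (Fintype.card ι : ℝ)⁻¹ := by
  rw [uniformRatio, mul_inv_rev, mul_inv_cancel_left₀ hi]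

variable [IsProbabilityMeasure μ]

lemma variance_inv_measureReal_eq : Var[fun i => (μ.real {i})⁻¹; μ]
    = (Fintype.card ι : ℝ) ^ 2 * Var[uniformRatio μ; μ] := by
  have := nonempty_of_isProbabilityMeasure μ
  have hscale (i : ι) : (μ.real {i})⁻¹ = Fintype.card ι * uniformRatio μ i := by
    rw [uniformRatio, mul_inv, mul_inv_cancel_left₀ (by simp)]
  simp only [hscale, variance_const_mul]

variable [MeasurableSingletonClass ι] (hμ : ∀ i, 0 < μ.real {i})
include hμ

lemma integral_uniformRatio : ∫ i, uniformRatio μ i ∂μ = 1 := by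
  have := nonempty_of_isProbabilityMeasure μ
  simp [integral_fintype .of_finite, measureReal_mul_uniformRatio (hμ _).ne']

lemma sum_mul_sq_uniformRatio_sub_one :
    ∑ i, μ.real {i} * (uniformRatio μ i - 1) ^ 2 = Var[uniformRatio μ; μ] := by
  rw [variance_eq_integral .of_discrete, integral_uniformRatio hμ, integral_fintype .of_finite]
  simp only [smul_eq_mul]

lemma sum_mul_abs_uniformRatio_sub_one_le :
    ∑ i, μ.real {i} * |uniformRatio μ i - 1| ≤ √Var[uniformRatio μ; μ] := by
  have h := integral_abs_sub_integral_le_sqrt_variance (P := μ) (f := uniformRatio μ) .of_discrete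
  rwa [integral_uniformRatio hμ, integral_fintype .of_finite] at h

lemma measureReal_singleton_le (i : ι) :
    μ.real {i} ≤ 2 / Fintype.card ι + Var[uniformRatio μ; μ] := by
  have hterm : μ.real {i} * (uniformRatio μ i - 1) ^ 2 ≤ Var[uniformRatio μ; μ] := by
    rw [← sum_mul_sq_uniformRatio_sub_one hμ]
    exact Finset.single_le_sum (f := fun i => μ.real {i} * (uniformRatio μ i - 1) ^ 2)
      (fun j _ => by positivity) (Finset.mem_univ i)
  have hexpand : μ.real {i} * (uniformRatio μ i - 1) ^ 2
      = μ.real {i} * uniformRatio μ i ^ 2 - 2 / Fintype.card ι + μ.real {i} := by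
    rw [div_eq_mul_inv, ← measureReal_mul_uniformRatio (hμ i).ne']
    ring
  have hsq : 0 ≤ μ.real {i} * uniformRatio μ i ^ 2 := by positivity
  linarith

lemma sum_sq_mul_abs_uniformRatio_sub_one_le :
    ∑ i, μ.real {i} ^ 2 * |uniformRatio μ i - 1|
      ≤ √Var[uniformRatio μ; μ] / Fintype.card ι
        + Var[uniformRatio μ; μ] * (2 / Fintype.card ι + Var[uniformRatio μ; μ]) := by
  set q := 2 / Fintype.card ι + Var[uniformRatio μ; μ]
  have hterm (i : ι) : μ.real {i} ^ 2 * |uniformRatio μ i - 1|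
      ≤ μ.real {i} * |uniformRatio μ i - 1| / Fintype.card ι
        + μ.real {i} * (uniformRatio μ i - 1) ^ 2 * q := by
    have hdev : μ.real {i} ≤ (Fintype.card ι : ℝ)⁻¹ + μ.real {i} * |uniformRatio μ i - 1| := by
      rw [← measureReal_mul_uniformRatio (hμ i).ne', ← mul_add]
      exact le_mul_of_one_le_right (hμ i).le
        (by linarith [neg_abs_le (uniformRatio μ i - 1)])
    calc μ.real {i} ^ 2 * |uniformRatio μ i - 1|
        = μ.real {i} * (μ.real {i} * |uniformRatio μ i - 1|) := by ring
      _ ≤ ((Fintype.card ι : ℝ)⁻¹ + μ.real {i} * |uniformRatio μ i - 1|)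
            * (μ.real {i} * |uniformRatio μ i - 1|) := by gcongr
      _ = μ.real {i} * |uniformRatio μ i - 1| / Fintype.card ι
            + μ.real {i} * (uniformRatio μ i - 1) ^ 2 * μ.real {i} := by
          rw [← sq_abs (uniformRatio μ i - 1)]
          ring
      _ ≤ _ := by
          gcongr
          exact measureReal_singleton_le hμ i
  refine (Finset.sum_le_sum fun i _ => hterm i).trans ?_
  rw [Finset.sum_add_distrib, ← Finset.sum_div, ← Finset.sum_mul,
    sum_mul_sq_uniformRatio_sub_one hμ]
  gcongr
  exact sum_mul_abs_uniformRatio_sub_one_le hμ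

lemma sum_measureReal_pow_three_le :
    ∑ i, μ.real {i} ^ 3 ≤ 2 / (Fintype.card ι : ℝ) ^ 2
      + 2 * Var[uniformRatio μ; μ] * (2 / Fintype.card ι + Var[uniformRatio μ; μ]) ^ 2 := by
  set q := 2 / Fintype.card ι + Var[uniformRatio μ; μ]
  have hterm (i : ι) : μ.real {i} ^ 3 ≤ μ.real {i} * (2 / (Fintype.card ι : ℝ) ^ 2)
      + 2 * (μ.real {i} * (uniformRatio μ i - 1) ^ 2) * q ^ 2 := by
    have hdev : μ.real {i} ^ 2
        ≤ 2 / (Fintype.card ι : ℝ) ^ 2 + 2 * (μ.real {i} * (uniformRatio μ i - 1)) ^ 2 := by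
      rw [div_eq_mul_inv, ← inv_pow, ← measureReal_mul_uniformRatio (hμ i).ne']
      linarith [sq_nonneg (μ.real {i} * (2 * uniformRatio μ i - 1))]
    calc μ.real {i} ^ 3 = μ.real {i} * μ.real {i} ^ 2 := by ring
      _ ≤ μ.real {i} * (2 / (Fintype.card ι : ℝ) ^ 2
            + 2 * (μ.real {i} * (uniformRatio μ i - 1)) ^ 2) := by gcongr
      _ = μ.real {i} * (2 / (Fintype.card ι : ℝ) ^ 2)
            + 2 * (μ.real {i} * (uniformRatio μ i - 1) ^ 2) * μ.real {i} ^ 2 := by ring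
      _ ≤ _ := by
          gcongr
          exact measureReal_singleton_le hμ i
  refine (Finset.sum_le_sum fun i _ => hterm i).trans_eq ?_
  rw [Finset.sum_add_distrib, ← Finset.sum_mul, ← Finset.sum_mul, ← Finset.mul_sum,
    sum_mul_sq_uniformRatio_sub_one hμ, sum_measureReal_singleton, Finset.coe_univ, probReal_univ,
    one_mul]

end UniformRatio

section WeightedCollisions

open Complex (exp I)

variable {ι : Type*} [Fintype ι] [DecidableEq ι] [MeasurableSpace ι]

/-- The number of pairs of observations of the sample that fall in a common class, a pair in class
`i` counting with weight `uniformRatio μ i`. Up to an affine map and a negligible linear term this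
is Pearson's statistic, see `pearsonChiSq_eq`. -/
noncomputable def weightedCollisions (μ : Measure ι) {n : ℕ} (x : Fin n → ι) : ℝ :=
  ∑ i, uniformRatio μ i * (sampleCount x i).choose 2

variable {μ : Measure ι} {n : ℕ}

lemma weightedCollisions_cons (j : ι) (x : Fin n → ι) :
    weightedCollisions μ (Fin.cons j x : Fin (n + 1) → ι)
      = weightedCollisions μ x + uniformRatio μ j * sampleCount x j := by
  simp [weightedCollisions, choose_sampleCount_cons, mul_add, Finset.sum_add_distrib]

variable [MeasurableSingletonClass ι]

lemma charFun_weightedCollisions_zero [SigmaFinite μ] (θ : ℝ) :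
    charFun ((sampleLaw μ 0).map (weightedCollisions μ)) θ = 1 := by
  rw [charFun_map_eq_integral .of_discrete, sampleLaw, Measure.pi_of_empty, integral_dirac]
  simp [weightedCollisions, sampleCount]

lemma charFun_weightedCollisions_succ [IsFiniteMeasure μ] (n : ℕ) (θ : ℝ) :
    charFun ((sampleLaw μ (n + 1)).map (weightedCollisions μ)) θ
      = ∫ x, exp ((θ * weightedCollisions μ x : ℝ) * I)
          * ∑ j, μ.real {j} * exp ((θ * (uniformRatio μ j * sampleCount x j) : ℝ) * I)
        ∂sampleLaw μ n := by
  rw [charFun_map_eq_integral .of_discrete, integral_sampleLaw_succ]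
  congr with x
  rw [Finset.mul_sum]
  refine Finset.sum_congr rfl fun j _ => ?_
  rw [weightedCollisions_cons, Complex.real_smul, mul_left_comm, ← Complex.exp_add, mul_add,
    Complex.ofReal_add, add_mul]

variable [IsProbabilityMeasure μ] (hμ : ∀ i, 0 < μ.real {i})
include hμ

-- The first-order term in the counts does not depend on the sample: the weights turn
-- `∑ j, p j * count j` into `n / m`.
lemma norm_sum_mul_exp_sampleCount_sub_le (θ : ℝ) (x : Fin n → ι) :
    ‖∑ j, μ.real {j} * exp ((θ * (uniformRatio μ j * sampleCount x j) : ℝ) * I)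
        - (1 + n / Fintype.card ι * (exp (θ * I) - 1))‖
      ≤ ∑ j, μ.real {j} * (2 * |θ| * (|uniformRatio μ j - 1| * sampleCount x j)
          + θ ^ 2 * (sampleCount x j).choose 2) := by
  have hmass : ∑ j, (μ.real {j} : ℂ) = 1 := by
    rw [← Complex.ofReal_sum]
    simp
  have hlinear : ∑ j, (μ.real {j} * (uniformRatio μ j * sampleCount x j) : ℂ)
      = n / Fintype.card ι := by
    have hj (j : ι) : (μ.real {j} * (uniformRatio μ j * sampleCount x j) : ℂ)
        = (sampleCount x j : ℂ) * (Fintype.card ι : ℂ)⁻¹ := by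
      rw [← mul_assoc, ← Complex.ofReal_mul, measureReal_mul_uniformRatio (hμ j).ne', mul_comm]
      push_cast
      rfl
    simp only [hj]
    rw [← Finset.sum_mul, ← Nat.cast_sum, sum_sampleCount, div_eq_mul_inv]
  have hsplit : ∑ j, μ.real {j} * exp ((θ * (uniformRatio μ j * sampleCount x j) : ℝ) * I)
        - (1 + n / Fintype.card ι * (exp (θ * I) - 1))
      = ∑ j, μ.real {j} * (exp ((θ * (uniformRatio μ j * sampleCount x j) : ℝ) * I) - 1
          - uniformRatio μ j * sampleCount x j * (exp (θ * I) - 1)) := by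
    rw [← hlinear, Finset.sum_mul, ← sub_sub]
    nth_rewrite 1 [← hmass]
    simp only [← Finset.sum_sub_distrib]
    refine Finset.sum_congr rfl fun j _ => ?_
    ring
  rw [hsplit]
  refine norm_sum_le_of_le _ fun j _ => ?_
  rw [norm_mul, Complex.norm_real, Real.norm_of_nonneg (hμ j).le]
  gcongr
  exact norm_exp_mul_I_sub_one_sub_le _ _ _

lemma norm_charFun_weightedCollisions_succ_sub_le (n : ℕ) (θ : ℝ) :
    ‖charFun ((sampleLaw μ (n + 1)).map (weightedCollisions μ)) θ
        - charFun ((sampleLaw μ n).map (weightedCollisions μ)) θ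
          * (1 + n / Fintype.card ι * (exp (θ * I) - 1))‖
      ≤ 2 * |θ| * n * ∑ j, μ.real {j} ^ 2 * |uniformRatio μ j - 1|
        + θ ^ 2 * n.choose 2 * ∑ j, μ.real {j} ^ 3 := by
  have hmean : ∫ x, ∑ j, μ.real {j} * (2 * |θ| * (|uniformRatio μ j - 1| * sampleCount x j)
        + θ ^ 2 * (sampleCount x j).choose 2) ∂sampleLaw μ n
      = 2 * |θ| * n * ∑ j, μ.real {j} ^ 2 * |uniformRatio μ j - 1|
        + θ ^ 2 * n.choose 2 * ∑ j, μ.real {j} ^ 3 := by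
    rw [integral_finsetSum _ fun _ _ => .of_finite, Finset.mul_sum, Finset.mul_sum,
      ← Finset.sum_add_distrib]
    refine Finset.sum_congr rfl fun j _ => ?_
    rw [integral_const_mul, integral_add .of_finite .of_finite, integral_const_mul,
      integral_const_mul, integral_const_mul, integral_sampleCount, integral_choose_sampleCount]
    ring
  rw [charFun_weightedCollisions_succ, charFun_map_eq_integral .of_discrete,
    ← integral_mul_const, ← integral_sub .of_finite .of_finite, ← hmean]
  refine norm_integral_le_of_norm_le .of_finite (ae_of_all _ fun x => ?_)
  rw [← mul_sub, norm_mul, Complex.norm_exp_ofReal_mul_I, one_mul]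
  exact norm_sum_mul_exp_sampleCount_sub_le hμ θ x

lemma norm_charFun_weightedCollisions_succ_sub_mul_exp_le (n : ℕ) (θ : ℝ) :
    ‖charFun ((sampleLaw μ (n + 1)).map (weightedCollisions μ)) θ
        - charFun ((sampleLaw μ n).map (weightedCollisions μ)) θ
          * exp (n / Fintype.card ι * (exp (θ * I) - 1))‖
      ≤ 2 * |θ| * n * ∑ j, μ.real {j} ^ 2 * |uniformRatio μ j - 1|
        + θ ^ 2 * (n.choose 2 * ∑ j, μ.real {j} ^ 3 + 3 * (n / Fintype.card ι) ^ 2) := by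
  set φ := charFun ((sampleLaw μ n).map (weightedCollisions μ)) θ
  set φ' := charFun ((sampleLaw μ (n + 1)).map (weightedCollisions μ)) θ
  set u : ℂ := n / Fintype.card ι * (exp (θ * I) - 1)
  have hφ : ‖φ‖ ≤ 1 := by
    have : IsProbabilityMeasure ((sampleLaw μ n).map (weightedCollisions μ)) :=
      Measure.isProbabilityMeasure_map .of_discrete
    exact norm_charFun_le_one θ
  have hu : ‖u‖ ≤ n / Fintype.card ι * |θ| := by
    rw [norm_mul, norm_div, Complex.norm_natCast, Complex.norm_natCast]
    gcongr
    exact norm_exp_ofReal_mul_I_sub_one_le θ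
  have hexp : ‖exp u - 1 - u‖ ≤ θ ^ 2 * (3 * (n / Fintype.card ι) ^ 2) := by
    calc ‖exp u - 1 - u‖ ≤ 3 * ‖u‖ ^ 2 :=
          norm_exp_sub_one_sub_id_le_of_re_nonpos (re_natCast_div_mul_exp_sub_one_nonpos _ _ θ)
      _ ≤ 3 * (n / Fintype.card ι * |θ|) ^ 2 := by gcongr
      _ = θ ^ 2 * (3 * (n / Fintype.card ι) ^ 2) := by rw [mul_pow, sq_abs]; ring
  calc ‖φ' - φ * exp u‖ = ‖(φ' - φ * (1 + u)) - φ * (exp u - 1 - u)‖ := by ring_nf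
    _ ≤ ‖φ' - φ * (1 + u)‖ + ‖φ‖ * ‖exp u - 1 - u‖ := by
        rw [← norm_mul]
        exact norm_sub_le _ _
    _ ≤ ‖φ' - φ * (1 + u)‖ + 1 * ‖exp u - 1 - u‖ := by gcongr
    _ ≤ _ := by linarith [norm_charFun_weightedCollisions_succ_sub_le hμ n θ]

lemma norm_charFun_weightedCollisions_sub_exp_le (n : ℕ) (θ : ℝ) :
    ‖charFun ((sampleLaw μ n).map (weightedCollisions μ)) θ
        - exp (n.choose 2 / Fintype.card ι * (exp (θ * I) - 1))‖
      ≤ n * (2 * |θ| * n * ∑ j, μ.real {j} ^ 2 * |uniformRatio μ j - 1|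
        + θ ^ 2 * ((n : ℝ) ^ 2 / 2 * ∑ j, μ.real {j} ^ 3 + 3 * (n / Fintype.card ι) ^ 2)) := by
  have hprod : exp (n.choose 2 / Fintype.card ι * (exp (θ * I) - 1))
      = ∏ l ∈ Finset.range n, exp (l / Fintype.card ι * (exp (θ * I) - 1)) := by
    rw [← Complex.exp_sum, ← Finset.sum_mul, ← Finset.sum_div, ← Nat.cast_sum,
      Finset.sum_range_id, Nat.choose_two_right]
  rw [hprod]
  refine norm_sub_prod_range_le
    (G := fun l => charFun ((sampleLaw μ l).map (weightedCollisions μ)) θ)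
    (charFun_weightedCollisions_zero θ)
    (fun l _ => norm_exp_le_one_of_re_nonpos (re_natCast_div_mul_exp_sub_one_nonpos _ _ θ))
    fun l hl => (norm_charFun_weightedCollisions_succ_sub_mul_exp_le hμ l θ).trans ?_
  have hchoose : (l.choose 2 : ℝ) ≤ (n : ℝ) ^ 2 / 2 :=
    calc (l.choose 2 : ℝ) ≤ (l : ℝ) ^ 2 / 2 := by
          rw [Nat.cast_choose_two]
          nlinarith [(Nat.cast_nonneg l : (0 : ℝ) ≤ l)]
      _ ≤ (n : ℝ) ^ 2 / 2 := by gcongr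
  gcongr

-- Every factor on the right converges: `n² / m` to `λ²`, and `V`, `n V` and `n⁻¹` to `0`.
lemma norm_charFun_weightedCollisions_sub_exp_le_variance (hn : n ≠ 0) (θ : ℝ) :
    ‖charFun ((sampleLaw μ n).map (weightedCollisions μ)) θ
        - exp (n.choose 2 / Fintype.card ι * (exp (θ * I) - 1))‖
      ≤ 2 * |θ| * ((n : ℝ) ^ 2 / Fintype.card ι * √Var[uniformRatio μ; μ]
          + 2 * ((n : ℝ) ^ 2 / Fintype.card ι) * Var[uniformRatio μ; μ]
          + (n * Var[uniformRatio μ; μ]) ^ 2)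
        + θ ^ 2 * (n * Var[uniformRatio μ; μ] * (2 * ((n : ℝ) ^ 2 / Fintype.card ι * (n : ℝ)⁻¹)
            + n * Var[uniformRatio μ; μ]) ^ 2
          + 4 * ((n : ℝ) ^ 2 / Fintype.card ι) ^ 2 * (n : ℝ)⁻¹) := by
  refine (norm_charFun_weightedCollisions_sub_exp_le hμ n θ).trans ?_
  have hsq := sum_sq_mul_abs_uniformRatio_sub_one_le hμ
  have hcube := sum_measureReal_pow_three_le hμ
  set V := Var[uniformRatio μ; μ]
  set m := Fintype.card ι
  calc _ ≤ n * (2 * |θ| * n * (√V / m + V * (2 / m + V))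
        + θ ^ 2 * ((n : ℝ) ^ 2 / 2 * (2 / (m : ℝ) ^ 2 + 2 * V * (2 / m + V) ^ 2)
          + 3 * (n / m) ^ 2)) := by gcongr
    _ = _ := by
      field_simp
      ring

end WeightedCollisions

section PoissonLimit

open Complex (exp I)

variable {ι : ℕ → Type*} [∀ n, Fintype (ι n)] {r : ℝ}

lemma tendsto_choose_two_div_card
    (hr : Tendsto (fun n : ℕ => (n : ℝ) ^ 2 / Fintype.card (ι n)) atTop (𝓝 r)) :
    Tendsto (fun n : ℕ => (n.choose 2 : ℝ) / Fintype.card (ι n)) atTop (𝓝 (r / 2)) := by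
  have hlim := (hr.mul (tendsto_inv_atTop_nhds_zero_nat (𝕜 := ℝ).const_sub 1)).div_const 2
  rw [sub_zero, mul_one] at hlim
  refine hlim.congr' ?_
  filter_upwards [eventually_ne_atTop 0] with n hn
  rw [Nat.cast_choose_two]
  field_simp

variable [∀ n, DecidableEq (ι n)] [∀ n, MeasurableSpace (ι n)]
  [∀ n, MeasurableSingletonClass (ι n)] {μ : ∀ n, Measure (ι n)}
  [∀ n, IsProbabilityMeasure (μ n)]

lemma tendsto_charFun_weightedCollisions (hμ : ∀ n i, 0 < (μ n).real {i})
    (hr : Tendsto (fun n : ℕ => (n : ℝ) ^ 2 / Fintype.card (ι n)) atTop (𝓝 r))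
    (hvar : Tendsto (fun n : ℕ => n * Var[uniformRatio (μ n); μ n]) atTop (𝓝 0))
    {θ : ℕ → ℝ} {θ₀ : ℝ} (hθ : Tendsto θ atTop (𝓝 θ₀)) :
    Tendsto (fun n => charFun ((sampleLaw (μ n) n).map (weightedCollisions (μ n))) (θ n))
      atTop (𝓝 (exp (r / 2 * (exp (θ₀ * I) - 1)))) := by
  have hinv : Tendsto (fun n : ℕ => (n : ℝ)⁻¹) atTop (𝓝 0) := tendsto_inv_atTop_nhds_zero_nat
  have hvar₀ : Tendsto (fun n => Var[uniformRatio (μ n); μ n]) atTop (𝓝 0) := by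
    have h := hinv.mul hvar
    rw [mul_zero] at h
    refine h.congr' ?_
    filter_upwards [eventually_ne_atTop 0] with n hn
    rw [inv_mul_cancel_left₀ (by simpa)]
  have hPoisson : Tendsto (fun n : ℕ =>
      exp (n.choose 2 / Fintype.card (ι n) * (exp (θ n * I) - 1)))
      atTop (𝓝 (exp (r / 2 * (exp (θ₀ * I) - 1)))) := by
    have hrate : Tendsto (fun n : ℕ => (n.choose 2 / Fintype.card (ι n) : ℂ)) atTop
        (𝓝 (r / 2)) := by
      simpa using (tendsto_choose_two_div_card hr).ofReal
    have hphase : Tendsto (fun n => exp (θ n * I)) atTop (𝓝 (exp (θ₀ * I))) :=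
      (hθ.ofReal.mul_const I).cexp
    exact (hrate.mul (hphase.sub_const 1)).cexp
  have herr := ((hθ.abs.const_mul 2).mul
      (((hr.mul hvar₀.sqrt).add ((hr.const_mul 2).mul hvar₀)).add (hvar.pow 2))).add
    ((hθ.pow 2).mul ((hvar.mul ((((hr.mul hinv).const_mul 2).add hvar).pow 2)).add
      (((hr.pow 2).const_mul 4).mul hinv)))
  have hdiff : Tendsto (fun n => charFun ((sampleLaw (μ n) n).map (weightedCollisions (μ n))) (θ n)
      - exp (n.choose 2 / Fintype.card (ι n) * (exp (θ n * I) - 1))) atTop (𝓝 0) := by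
    refine squeeze_zero_norm' ?_ (by simpa using herr)
    filter_upwards [eventually_ne_atTop 0] with n hn
    exact norm_charFun_weightedCollisions_sub_exp_le_variance (hμ n) hn (θ n)
  simpa using hdiff.add hPoisson

end PoissonLimit

section Pearson

open Complex (exp I)

variable {m n : ℕ} {μ : Measure (Fin m)}

lemma empiricalFreq_eq_inv_mul_sampleCount (x : Fin n → Fin m) (i : Fin m) :
    empiricalFreq x i = (n : ℝ)⁻¹ * sampleCount x i := by
  simp [empiricalFreq, sampleCount]

variable [IsProbabilityMeasure μ] (hμ : ∀ i, 0 < μ.real {i})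
include hμ

lemma pearsonChiSq_eq (hn : n ≠ 0) (x : Fin n → Fin m) :
    pearsonChiSq (fun i => μ.real {i}) x
      = m / n * (2 * weightedCollisions μ x + ∑ k, (uniformRatio μ (x k) - 1)) + m - n := by
  obtain ⟨i₀⟩ := nonempty_of_isProbabilityMeasure μ
  have hm : (m : ℝ) ≠ 0 := by exact_mod_cast i₀.pos.ne'
  have hcount : ∑ i, (sampleCount x i : ℝ) = n := by exact_mod_cast sum_sampleCount x
  have hterm (i : Fin m) : n * ((empiricalFreq x i - μ.real {i}) ^ 2 / μ.real {i})
      = 2 * m / n * (uniformRatio μ i * (sampleCount x i).choose 2)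
        + m / n * ((uniformRatio μ i - 1) * sampleCount x i)
        + (m / n - 2) * sampleCount x i + n * μ.real {i} := by
    have := (hμ i).ne'
    rw [empiricalFreq_eq_inv_mul_sampleCount, uniformRatio, Fintype.card_fin, Nat.cast_choose_two]
    field_simp
    ring
  rw [pearsonChiSq, Finset.mul_sum]
  simp only [hterm, Finset.sum_add_distrib, ← Finset.mul_sum, hcount, sum_measureReal_singleton,
    Finset.coe_univ, probReal_univ]
  rw [sum_mul_sampleCount (fun i => uniformRatio μ i - 1) x, weightedCollisions]
  field_simp
  ring

lemma pearsonChiSq_sub_div_sqrt_eq (hn : n ≠ 0) (x : Fin n → Fin m) :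
    (pearsonChiSq (fun i => μ.real {i}) x - m) / √(2 * m)
      = √(2 * m) / n * (weightedCollisions μ x + (∑ k, (uniformRatio μ (x k) - 1)) / 2)
        - (√(2 * m) / n)⁻¹ := by
  obtain ⟨i₀⟩ := nonempty_of_isProbabilityMeasure μ
  have hm : 0 < m := i₀.pos
  have hsqrt : √(2 * (m : ℝ)) ≠ 0 := by positivity
  have hm_eq : (m : ℝ) = √(2 * (m : ℝ)) ^ 2 / 2 := by
    rw [Real.sq_sqrt (by positivity)]
    ring
  rw [pearsonChiSq_eq hμ hn]
  generalize √(2 * (m : ℝ)) = s at *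
  rw [hm_eq]
  field_simp
  ring

lemma norm_charFun_pearsonChiSq_sub_le (hn : n ≠ 0) (t : ℝ) :
    ‖charFun ((sampleLaw μ n).map fun x =>
          (pearsonChiSq (fun i => μ.real {i}) x - m) / √(2 * m)) t
        - exp ((-(t * (√(2 * m) / n)⁻¹) : ℝ) * I)
          * charFun ((sampleLaw μ n).map (weightedCollisions μ)) (t * (√(2 * m) / n))‖
      ≤ |t| * (√(2 * m) / n / 2 * √(n * Var[uniformRatio μ; μ])) := by
  set c := √(2 * (m : ℝ)) / n
  rw [← charFun_map_mul_sub .of_discrete]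
  refine (norm_charFun_map_sub_le .of_discrete .of_discrete .of_finite t).trans ?_
  have hdiff (x : Fin n → Fin m) : |(pearsonChiSq (fun i => μ.real {i}) x - m) / √(2 * m)
      - (c * weightedCollisions μ x - c⁻¹)| = c / 2 * |∑ k, (uniformRatio μ (x k) - 1)| := by
    calc _ = |c / 2 * ∑ k, (uniformRatio μ (x k) - 1)| := by
          rw [pearsonChiSq_sub_div_sqrt_eq hμ hn]
          congr 1
          ring
      _ = _ := by rw [abs_mul, abs_of_nonneg (by positivity)]
  have hlinear := integral_abs_sum_sub_integral_le (μ := μ) (g := uniformRatio μ) .of_discrete n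
  rw [integral_uniformRatio hμ] at hlinear
  simp only [hdiff, integral_const_mul]
  gcongr

end Pearson

section PearsonLimit

open Complex (exp I)

variable {m : ℕ → ℕ} {μ : ∀ n, Measure (Fin (m n))} [∀ n, IsProbabilityMeasure (μ n)] {lam : ℝ}

lemma tendsto_mul_variance_uniformRatio
    (hC : Tendsto (fun n : ℕ => Var[fun i => ((μ n).real {i})⁻¹; μ n] / ((m n : ℝ) * n))
      atTop (𝓝 0))
    (hrate : Tendsto (fun n : ℕ => (n : ℝ) / √(m n : ℝ)) atTop (𝓝 lam)) :
    Tendsto (fun n : ℕ => n * Var[uniformRatio (μ n); μ n]) atTop (𝓝 0) := by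
  have h := hC.mul (hrate.pow 2)
  rw [zero_mul] at h
  refine h.congr' ?_
  filter_upwards [eventually_ne_atTop 0] with n hn
  obtain ⟨i₀⟩ := nonempty_of_isProbabilityMeasure (μ n)
  have hm : (m n : ℝ) ≠ 0 := by exact_mod_cast i₀.pos.ne'
  rw [variance_inv_measureReal_eq, Fintype.card_fin, div_pow, Real.sq_sqrt (Nat.cast_nonneg _)]
  field_simp

lemma tendsto_charFun_pearsonChiSq
    (hμ : ∀ n i, 0 < (μ n).real {i}) (hlam : 0 < lam)
    (hrate : Tendsto (fun n : ℕ => (n : ℝ) / √(m n : ℝ)) atTop (𝓝 lam))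
    (hvar : Tendsto (fun n : ℕ => n * Var[uniformRatio (μ n); μ n]) atTop (𝓝 0)) (t : ℝ) :
    Tendsto (fun n => charFun ((sampleLaw (μ n) n).map fun x =>
        (pearsonChiSq (fun i => (μ n).real {i}) x - m n) / √(2 * m n)) t)
      atTop (𝓝 (exp ((-(t * (lam / √2)) : ℝ) * I)
        * exp ((lam ^ 2 / 2 : ℝ) * (exp ((t * (√2 / lam) : ℝ) * I) - 1)))) := by
  have hscale : Tendsto (fun n : ℕ => √(2 * m n) / n) atTop (𝓝 (√2 / lam)) := by
    refine (hrate.inv₀ hlam.ne').const_mul √2 |>.congr fun n => ?_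
    rw [Real.sqrt_mul zero_le_two, inv_div, mul_div_assoc]
  have hr : Tendsto (fun n : ℕ => (n : ℝ) ^ 2 / Fintype.card (Fin (m n))) atTop
      (𝓝 (lam ^ 2)) := by
    refine (hrate.pow 2).congr fun n => ?_
    rw [div_pow, Real.sq_sqrt (Nat.cast_nonneg _), Fintype.card_fin]
  have hcoll := tendsto_charFun_weightedCollisions hμ hr hvar (hscale.const_mul t)
  have hshift : Tendsto (fun n : ℕ => (-(t * (√(2 * m n) / n)⁻¹) : ℝ)) atTop
      (𝓝 (-(t * (lam / √2)))) := by
    have h := ((hscale.inv₀ (by positivity)).const_mul t).neg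
    rwa [inv_div] at h
  have hmain := ((hshift.ofReal.mul_const I).cexp).mul hcoll
  have herr := ((hscale.div_const 2).mul hvar.sqrt).const_mul |t|
  rw [Real.sqrt_zero, mul_zero, mul_zero] at herr
  have hdiff := squeeze_zero_norm' ((eventually_ne_atTop 0).mono fun n hn =>
    norm_charFun_pearsonChiSq_sub_le (hμ n) hn t) herr
  simpa using hdiff.add hmain

end PearsonLimit

theorem theorem1
    (m : ℕ → ℕ) (p : ∀ n, Fin (m n) → ℝ)
    {Ω : ℕ → Type*} [∀ n, MeasurableSpace (Ω n)]
    (P : ∀ n, Measure (Ω n)) [∀ n, IsProbabilityMeasure (P n)]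
    -- the generic variable `X_n` and the sample `X_{n,1}, …, X_{n,n}`
    (X₀ : ∀ n, Ω n → Fin (m n)) (X : ∀ n, Fin n → Ω n → Fin (m n))
    (hX₀ : ∀ n, Measurable (X₀ n)) (hX : ∀ n k, Measurable (X n k))
    (hp : ∀ n i, (P n).real {ω | X₀ n ω = i} = p n i) (hp_pos : ∀ n i, 0 < p n i)
    (hindep : ∀ n, iIndepFun (X n) (P n))
    (hident : ∀ n k, IdentDistrib (X n k) (X₀ n) (P n) (P n))
    (hC : Tendsto (fun n : ℕ => Var[fun ω => (p n (X₀ n ω))⁻¹; P n] / ((m n : ℝ) * n))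
      atTop (𝓝 0))
    (lam : ℝ) (hlam : 0 < lam)
    (hrate : Tendsto (fun n : ℕ => (n : ℝ) / √(m n : ℝ)) atTop (𝓝 lam))
    {Ω' : Type*} [MeasurableSpace Ω'] (P' : Measure Ω') [IsProbabilityMeasure P']
    (Z : Ω' → ℕ) (hZ : HasLaw Z (poissonMeasure ⟨lam ^ 2 / 2, by positivity⟩) P') :
    TendstoInDistribution
      (fun n ω => (pearsonChiSq (p n) (fun k => X n k ω) - (m n : ℝ)) / √(2 * (m n : ℝ)))
      atTop
      (fun ω' => √2 / lam * (Z ω' : ℝ) - lam / √2)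
      P P' := by
  have hprob n : IsProbabilityMeasure ((P n).map (X₀ n)) :=
    Measure.isProbabilityMeasure_map (hX₀ n).aemeasurable
  obtain rfl : p = fun n i => ((P n).map (X₀ n)).real {i} := by
    ext n i
    rw [← hp, map_measureReal_apply (hX₀ n) (measurableSet_singleton i)]
    rfl
  have hvar := tendsto_mul_variance_uniformRatio (μ := fun n => (P n).map (X₀ n))
    (by simpa only [variance_map .of_discrete (hX₀ _).aemeasurable, Function.comp_def] using hC)
    hrate
  have hlaw n := HasLaw.fun_comp
    (Y := fun x => (pearsonChiSq (fun i => ((P n).map (X₀ n)).real {i}) x - m n) / √(2 * m n))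
    ⟨.of_discrete, rfl⟩ (hasLaw_sampleLaw (hindep n) (hident n))
  have hZ_meas := hZ.aemeasurable
  refine ⟨fun n => (hlaw n).aemeasurable, by fun_prop,
    ProbabilityMeasure.tendsto_iff_tendsto_charFun.2 fun t => ?_⟩
  simp only [ProbabilityMeasure.coe_mk, (hlaw _).map_eq]
  rw [charFun_map_mul_natCast_sub hZ]
  exact tendsto_charFun_pearsonChiSq hp_pos hlam hrate hvar t
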